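/- **Conventions.** "Small" and "set" refer to a fixed universe. A *model category* is a complete and cocomplete, locally small category $\mathcal M$ with classes of cofibrations, fibrations and weak equivalences such that (acyclic cofibrations, fibrations) and (cofibrations, acyclic fibrations) are weak factorization systems (wfs) and the weak equivalences satisfy 2-out-of-3. A map in $\mathcal M$ is a *couniversal* (resp. *universal*) *weak equivalence* if every pushout (resp. every pullback) of it is a weak equivalence. If $(\mathcal L,\mathcal R)$ is a wfs on a category, an *$\mathcal L$-object* is an object $X$ with $(\emptyset\to X)\in\mathcal L$. For a small category $\mathcal K$ and $X:\mathcal K\to\mathcal M$, write $U\otimes_{\mathcal K}X$ for the colimit of $X$ weighted by $U:\mathcal K^{\mathrm{op}}\to\mathbf{Set}$ and $\{W,X\}^{\mathcal K}$ for the limit of $X$ weighted by $W:\mathcal K\to\mathbf{Set}$. **Bistratified categories.** *Abstract bigluing data* from $\mathcal A$ to $\mathcal D$ consist of functors $U:\mathcal A^{\mathrm{op}}\times\mathcal D\to\mathbf{Set}$ and $W:\mathcal D^{\mathrm{op}}\times\mathcal A\to\mathbf{Set}$ and maps $\alpha:W(d,c')\times U(c,d)\to\mathcal A(c,c')$, natural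 in $c,c'\in\mathcal A$ and dinatural in $d\in\mathcal D$. Their *collage* has as objects the disjoint union of those of $\mathcal A$ and $\mathcal D$, and as hom-sets $\mathcal A(c,c')$, $U(c,d)$ (from $c$ to $d$), $W(d,c)$ (from $d$ to $c$) and $\mathcal D(d,d')\sqcup\int^{c\in\mathcal A}U(c,d')\times W(d,c)$ (from $d$ to $d'$), with the evident composition. Let $\mathcal C$ be a small category with an ordinal degree $\deg x$ for each object $x$, and let $\mathcal C_\delta$ be the full subcategory on the objects of degree $<\delta$. Then $\mathcal C$ is *bistratified with discrete strata* if for every ordinal $\delta$ the inclusion $\mathcal C_\delta\hookrightarrow\mathcal C_{\delta+1}$ is isomorphic, under $\mathcal C_\delta$, to the inclusion of $\mathcal C_\delta$ in the collage of abstract bigluing data from $\mathcal C_\delta$ to some discrete category. The category $\mathcal C^{\mathrm{op}}$ is given the same degrees. **Reedy wfs.** For $A:\mathcal C\to\mathcal M$ and $x\in\mathcal C$ of degree $\delta$, let $L_xA=\mathcal C(-,x)\otimes_{\mathcal C_\delta}A$ and $M_xA=\{\mathcal C(x,-),A\}^{\mathcal C_\delta}$, with the canonical maps $L_xA\to A_x\to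 M_xA$. A wfs $(\mathcal L,\mathcal R)$ on a complete and cocomplete $\mathcal M$ induces the *Reedy wfs* on $\mathcal M^{\mathcal C}$: a map $A\to B$ is in its left class iff $L_xB\sqcup_{L_xA}A_x\to B_x$ is in $\mathcal L$ for all $x$, and in its right class iff $A_x\to M_xA\times_{M_xB}B_x$ is in $\mathcal R$ for all $x$. If $\mathcal M$ is a model category, the *Reedy acyclic cofibrations* (resp. *Reedy acyclic fibrations*) are the left class of the Reedy wfs induced by (acyclic cofibrations, fibrations) (resp. the right class of the Reedy wfs induced by (cofibrations, acyclic fibrations)). **Theorem.** Let $\mathcal C$ be bistratified with discrete strata, and suppose that for every model category $\mathcal M$ the two Reedy wfs on $\mathcal M^{\mathcal C}$, induced by (acyclic cofibrations, fibrations) and (cofibrations, acyclic fibrations), are respectively the (acyclic cofibration, fibration) and (cofibration, acyclic fibration) wfs of a model structure on $\mathcal M^{\mathcal C}$ whose weak equivalences are the objectwise weak equivalences. Let $U:\mathcal C^{\mathrm{op}}\to\mathbf{Set}$ and $W:\mathcal C\to\mathbf{Set}$, and give $\mathbf{Set}^{\mathcal C^{\mathrm{op}}}$ and $\mathbf{Set}^{\mathcal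 C}$ the Reedy wfs induced by the wfs (injections, surjections) on $\mathbf{Set}$. 1. The functor $U\otimes_{\mathcal C}(-):\mathcal M^{\mathcal C}\to\mathcal M$ takes Reedy acyclic cofibrations to couniversal weak equivalences for all model categories $\mathcal M$ if and only if $U$ is an $\mathcal L$-object of $\mathbf{Set}^{\mathcal C^{\mathrm{op}}}$. 2. The functor $\{W,-\}^{\mathcal C}:\mathcal M^{\mathcal C}\to\mathcal M$ takes Reedy acyclic fibrations to universal weak equivalences for all model categories $\mathcal M$ if and only if $W$ is an $\mathcal L$-object of $\mathbf{Set}^{\mathcal C}$. -/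

import Mathlib

open CategoryTheory CategoryTheory.Limits CategoryTheory.MorphismProperty Opposite HomotopicalAlgebra

universe v u

/-! ## Abstract bigluing data and their collages -/

/-- Abstract bigluing data from a category `A` to a category `D`: profunctors `U(c, d)`
(contravariant in `c : A`, covariant in `d : D`) and `W(d, c)` (contravariant in `d : D`,
covariant in `c : A`) together with a map `α : W ⊗_D U ⟶ A(-, -)` of profunctors, given by
maps `W(d, c') × U(c, d) → A(c, c')` natural in `c` and `c'` and balanced over `d`. -/
structure BigluingData (A : Type u) [SmallCategory A] (D : Type u) [SmallCategory D] where
  U : D ⥤ Aᵒᵖ ⥤ Type u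
  W : Dᵒᵖ ⥤ A ⥤ Type u
  α : ∀ {c c' : A} {d : D}, (U.obj d).obj (op c) → (W.obj (op d)).obj c' → (c ⟶ c')
  α_left : ∀ {b c c' : A} {d : D} (f : b ⟶ c) (s : (U.obj d).obj (op c))
    (t : (W.obj (op d)).obj c'), α ((U.obj d).map f.op s) t = f ≫ α s t
  α_right : ∀ {c c' b : A} {d : D} (s : (U.obj d).obj (op c))
    (t : (W.obj (op d)).obj c') (f : c' ⟶ b), α s ((W.obj (op d)).map f t) = α s t ≫ f
  α_balanced : ∀ {c c' : A} {d d' : D} (s : (U.obj d).obj (op c)) (g : d ⟶ d')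
    (t : (W.obj (op d')).obj c'), α ((U.map g).app (op c) s) t = α s ((W.map g.op).app c' t)

namespace BigluingData

variable {A : Type u} [SmallCategory A] {D : Type u} [SmallCategory D] (B : BigluingData A D)

/-- `b ⟶ c ⟶ d`. -/
def ul {b c : A} {d : D} (f : b ⟶ c) (s : (B.U.obj d).obj (op c)) : (B.U.obj d).obj (op b) :=
  (B.U.obj d).map f.op s

/-- `c ⟶ d ⟶ d'`. -/
def ur {c : A} {d d' : D} (s : (B.U.obj d).obj (op c)) (g : d ⟶ d') : (B.U.obj d').obj (op c) :=
  (B.U.map g).app (op c) s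

/-- `d ⟶ d' ⟶ c`. -/
def wl {d d' : D} {c : A} (g : d ⟶ d') (t : (B.W.obj (op d')).obj c) : (B.W.obj (op d)).obj c :=
  (B.W.map g.op).app c t

/-- `d ⟶ c ⟶ c'`. -/
def wr {d : D} {c c' : A} (t : (B.W.obj (op d)).obj c) (f : c ⟶ c') : (B.W.obj (op d)).obj c' :=
  (B.W.obj (op d)).map f t

section Laws

variable {a b c e : A} {d d' d'' : D}

lemma ul_id (s : (B.U.obj d).obj (op c)) : B.ul (𝟙 c) s = s := by simp [ul]

lemma ur_id (s : (B.U.obj d).obj (op c)) : B.ur s (𝟙 d) = s := by simp [ur]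

lemma wl_id (t : (B.W.obj (op d)).obj c) : B.wl (𝟙 d) t = t := by simp [wl]

lemma wr_id (t : (B.W.obj (op d)).obj c) : B.wr t (𝟙 c) = t := by simp [wr]

lemma ul_ul (f : a ⟶ b) (g : b ⟶ c) (s : (B.U.obj d).obj (op c)) :
    B.ul f (B.ul g s) = B.ul (f ≫ g) s := by simp [ul]

lemma ur_ur (s : (B.U.obj d).obj (op c)) (g : d ⟶ d') (h : d' ⟶ d'') :
    B.ur (B.ur s g) h = B.ur s (g ≫ h) := by simp [ur]

lemma ur_ul (f : b ⟶ c) (s : (B.U.obj d).obj (op c)) (g : d ⟶ d') :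
    B.ur (B.ul f s) g = B.ul f (B.ur s g) := by simp [ur, ul, NatTrans.naturality_apply]

lemma wl_wl (g : d ⟶ d') (h : d' ⟶ d'') (t : (B.W.obj (op d'')).obj c) :
    B.wl g (B.wl h t) = B.wl (g ≫ h) t := by simp [wl]

lemma wr_wr (t : (B.W.obj (op d)).obj a) (f : a ⟶ b) (g : b ⟶ c) :
    B.wr (B.wr t f) g = B.wr t (f ≫ g) := by simp [wr]

lemma wr_wl (g : d ⟶ d') (t : (B.W.obj (op d')).obj b) (f : b ⟶ c) :
    B.wr (B.wl g t) f = B.wl g (B.wr t f) := by simp [wr, wl, NatTrans.naturality_apply]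

lemma α_ul (f : a ⟶ b) (s : (B.U.obj d).obj (op b)) (t : (B.W.obj (op d)).obj c) :
    B.α (B.ul f s) t = f ≫ B.α s t := B.α_left f s t

lemma α_wr (s : (B.U.obj d).obj (op b)) (t : (B.W.obj (op d)).obj c) (f : c ⟶ e) :
    B.α s (B.wr t f) = B.α s t ≫ f := B.α_right s t f

lemma α_ur (s : (B.U.obj d).obj (op b)) (g : d ⟶ d') (t : (B.W.obj (op d')).obj c) :
    B.α (B.ur s g) t = B.α s (B.wl g t) := B.α_balanced s g t

end Laws

/-- The relation defining `(U ⊗_A W)(d, d')` as a quotient of `∐_c W(d, c) × U(c, d')`. -/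
inductive TensorRel (d d' : D) :
    (Σ c : A, (B.W.obj (op d)).obj c × (B.U.obj d').obj (op c)) →
    (Σ c : A, (B.W.obj (op d)).obj c × (B.U.obj d').obj (op c)) → Prop
  | mk {c c' : A} (k : c ⟶ c') (t : (B.W.obj (op d)).obj c) (s : (B.U.obj d').obj (op c')) :
      TensorRel d d' ⟨c, t, B.ul k s⟩ ⟨c', B.wr t k, s⟩

/-- The set `(U ⊗_A W)(d, d')` of formal composites `d ⟶ c ⟶ d'` through objects of `A`. -/
def Tensor (d d' : D) : Type u := Quot (B.TensorRel d d')

/-- The formal composite of `t : d ⟶ c` and `s : c ⟶ d'`. -/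
def tmk {d d' : D} {c : A} (t : (B.W.obj (op d)).obj c) (s : (B.U.obj d').obj (op c)) :
    B.Tensor d d' := Quot.mk _ ⟨c, t, s⟩

lemma tmk_ul {d d' : D} {c c' : A} (k : c ⟶ c') (t : (B.W.obj (op d)).obj c)
    (s : (B.U.obj d').obj (op c')) : B.tmk t (B.ul k s) = B.tmk (B.wr t k) s :=
  Quot.sound (TensorRel.mk k t s)

lemma tensor_ind {d d' : D} {P : B.Tensor d d' → Prop}
    (h : ∀ (c : A) (t : (B.W.obj (op d)).obj c) (s : (B.U.obj d').obj (op c)), P (B.tmk t s))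
    (q : B.Tensor d d') : P q := Quot.ind (fun p => h p.1 p.2.1 p.2.2) q

/-- Maps out of `(U ⊗_A W)(d, d')`. -/
def tlift {d d' : D} {X : Type u}
    (φ : ∀ {c : A}, (B.W.obj (op d)).obj c → (B.U.obj d').obj (op c) → X)
    (h : ∀ {c c' : A} (k : c ⟶ c') (t : (B.W.obj (op d)).obj c) (s : (B.U.obj d').obj (op c')),
      φ t (B.ul k s) = φ (B.wr t k) s) (q : B.Tensor d d') : X :=
  Quot.lift (fun p => φ p.2.1 p.2.2) (by rintro _ _ ⟨k, t, s⟩; exact h k t s) q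

/-- `c ⟶ d ⟶ d'` with the second arrow a formal composite. -/
def ut {c : A} {d d' : D} (s : (B.U.obj d).obj (op c)) : B.Tensor d d' → (B.U.obj d').obj (op c) :=
  B.tlift (fun t r => B.ul (B.α s t) r) (by intros; simp only [α_wr, ul_ul])

/-- `d ⟶ d' ⟶ c` with the first arrow a formal composite. -/
def tw {d d' : D} {c : A} (q : B.Tensor d d') (t : (B.W.obj (op d')).obj c) :
    (B.W.obj (op d)).obj c :=
  B.tlift (fun r s => B.wr r (B.α s t)) (by intros; simp only [α_ul, wr_wr]) q

/-- `d ⟶ d' ⟶ d''` with the second arrow a formal composite. -/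
def dt {d d' d'' : D} (g : d ⟶ d') : B.Tensor d' d'' → B.Tensor d d'' :=
  B.tlift (fun t s => B.tmk (B.wl g t) s) (by intros; simp only [tmk_ul, wr_wl])

/-- `d ⟶ d' ⟶ d''` with the first arrow a formal composite. -/
def td {d d' d'' : D} (q : B.Tensor d d') (g : d' ⟶ d'') : B.Tensor d d'' :=
  B.tlift (fun t s => B.tmk t (B.ur s g)) (by intros; simp only [← tmk_ul, ur_ul]) q

/-- `d ⟶ d' ⟶ d''` with both arrows formal composites. -/
def tt {d d' d'' : D} (q : B.Tensor d d') (r : B.Tensor d' d'') : B.Tensor d d'' :=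
  B.tlift (fun t s => B.tmk t (B.ut s r))
    (by
      intro c c' k t s
      induction r using B.tensor_ind with | h e t' s' =>
      simp only [ut, tlift, tmk, ← ul_ul, α_ul]
      exact B.tmk_ul k t _) q

section TensorLaws

variable {a b c e : A} {d d' d'' : D}

lemma ut_tmk (s : (B.U.obj d).obj (op c)) (t : (B.W.obj (op d)).obj e)
    (r : (B.U.obj d').obj (op e)) : B.ut s (B.tmk t r) = B.ul (B.α s t) r := rfl

lemma tw_tmk (t : (B.W.obj (op d)).obj e) (s : (B.U.obj d').obj (op e))
    (r : (B.W.obj (op d')).obj c) : B.tw (B.tmk t s) r = B.wr t (B.α s r) := rfl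

lemma dt_tmk (g : d ⟶ d') (t : (B.W.obj (op d')).obj e) (s : (B.U.obj d'').obj (op e)) :
    B.dt g (B.tmk t s) = B.tmk (B.wl g t) s := rfl

lemma td_tmk (t : (B.W.obj (op d)).obj e) (s : (B.U.obj d').obj (op e)) (g : d' ⟶ d'') :
    B.td (B.tmk t s) g = B.tmk t (B.ur s g) := rfl

lemma tt_tmk (t : (B.W.obj (op d)).obj e) (s : (B.U.obj d').obj (op e)) (q : B.Tensor d' d'') :
    B.tt (B.tmk t s) q = B.tmk t (B.ut s q) := rfl

end TensorLaws

/-- The objects of the collage of abstract bigluing data: the disjoint union of those of `A`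
and those of `D`. -/
inductive Collage (B : BigluingData A D) : Type u
  | old (c : A) : Collage B
  | new (d : D) : Collage B

namespace Collage

/-- The morphisms of the collage: `A(c, c')`, `U(c, d)`, `W(d, c)` and the disjoint union of
`D(d, d')` and `(U ⊗_A W)(d, d')`. -/
inductive Hom : B.Collage → B.Collage → Type u
  | oo {c c' : A} (f : c ⟶ c') : Hom (old c) (old c')
  | on {c : A} {d : D} (s : (B.U.obj d).obj (op c)) : Hom (old c) (new d)
  | no {d : D} {c : A} (t : (B.W.obj (op d)).obj c) : Hom (new d) (old c)
  | nn {d d' : D} (g : d ⟶ d') : Hom (new d) (new d')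
  | nt {d d' : D} (q : B.Tensor d d') : Hom (new d) (new d')

/-- Identities of the collage. -/
def id : ∀ x : B.Collage, Hom B x x
  | old c => .oo (𝟙 c)
  | new d => .nn (𝟙 d)

/-- Composition of the collage. -/
def comp : ∀ {x y z : B.Collage}, Hom B x y → Hom B y z → Hom B x z
  | _, _, _, .oo f, .oo g => .oo (f ≫ g)
  | _, _, _, .oo f, .on s => .on (B.ul f s)
  | _, _, _, .on s, .no t => .oo (B.α s t)
  | _, _, _, .on s, .nn g => .on (B.ur s g)
  | _, _, _, .on s, .nt q => .on (B.ut s q)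
  | _, _, _, .no t, .oo f => .no (B.wr t f)
  | _, _, _, .no t, .on s => .nt (B.tmk t s)
  | _, _, _, .nn g, .no t => .no (B.wl g t)
  | _, _, _, .nt q, .no t => .no (B.tw q t)
  | _, _, _, .nn f, .nn g => .nn (f ≫ g)
  | _, _, _, .nn f, .nt q => .nt (B.dt f q)
  | _, _, _, .nt q, .nn g => .nt (B.td q g)
  | _, _, _, .nt q, .nt r => .nt (B.tt q r)

end Collage

/-- The collage of abstract bigluing data. -/
instance : SmallCategory B.Collage where
  Hom := Collage.Hom B
  id := Collage.id B
  comp := Collage.comp B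
  id_comp := by
    rintro _ _ (f | s | t | g | q)
    · simp only [Collage.comp, Collage.id, Category.id_comp]
    · simp only [Collage.comp, Collage.id, ul_id]
    · simp only [Collage.comp, Collage.id, wl_id]
    · simp only [Collage.comp, Collage.id, Category.id_comp]
    · induction q using B.tensor_ind
      simp only [Collage.comp, Collage.id, dt_tmk, wl_id]
  comp_id := by
    rintro _ _ (f | s | t | g | q)
    · simp only [Collage.comp, Collage.id, Category.comp_id]
    · simp only [Collage.comp, Collage.id, ur_id]
    · simp only [Collage.comp, Collage.id, wr_id]
    · simp only [Collage.comp, Collage.id, Category.comp_id]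
    · induction q using B.tensor_ind
      simp only [Collage.comp, Collage.id, td_tmk, ur_id]
  assoc := by
    rintro _ _ _ _ (f | f | f | f | f) (g | g | g | g | g) (h | h | h | h | h) <;>
      (try induction f using B.tensor_ind) <;> (try induction g using B.tensor_ind) <;>
      (try induction h using B.tensor_ind) <;>
      simp only [Collage.comp, Category.assoc, ut_tmk, tw_tmk, dt_tmk, td_tmk, tt_tmk,
        ul_ul, ur_ur, ur_ul, wl_wl, wr_wr, wr_wl, α_ul, α_wr, α_ur, tmk_ul]

/-- The inclusion of `A` in the collage. -/
def inclOld : A ⥤ B.Collage where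
  obj c := .old c
  map f := Collage.Hom.oo f

end BigluingData

/-! ## Bistratified categories with discrete strata -/

section Bistratified

variable {C : Type u} [SmallCategory C] (deg : C → Ordinal.{v})

/-- The objects of degree `< δ`; they span the full subcategory `C_δ`. -/
def degLT (δ : Ordinal.{v}) : ObjectProperty C := fun x => deg x < δ

/-- The objects of degree `≤ δ`; they span the full subcategory `C_{δ+1}`. -/
def degLE (δ : Ordinal.{v}) : ObjectProperty C := fun x => deg x ≤ δ

lemma degLT_le_degLE (δ : Ordinal.{v}) : degLT deg δ ≤ degLE deg δ :=
  fun _ h => le_of_lt (α := Ordinal.{v}) h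

/-- `C` is bistratified with discrete strata, with degree function `deg`: it is obtained by
transfinitely iterating collages of abstract bigluing data whose target (the new stratum) is a
discrete category. That is, for every `δ` the inclusion `C_δ ⟶ C_{δ+1}` is, up to isomorphism of
categories under `C_δ`, the inclusion of `C_δ` in such a collage. (The full subcategories `C_δ`
start with the empty category, exhaust `C`, and `C_δ` is the union of the `C_δ'`, `δ' < δ`, when
`δ` is a limit ordinal, so nothing has to be required at limit stages.) -/
def IsBistratifiedDiscrete : Prop :=
  ∀ δ : Ordinal.{v}, ∃ (D : Type u) (_ : SmallCategory D)
    (B : BigluingData (degLT deg δ).FullSubcategory D)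
    (F : B.Collage ⥤ (degLE deg δ).FullSubcategory),
    IsDiscrete D ∧ Function.Bijective F.obj ∧ F.Full ∧ F.Faithful ∧
      B.inclOld ⋙ F = ObjectProperty.ιOfLE (degLT_le_degLE deg δ)

end Bistratified

/-! ## Weighted limits and colimits -/

noncomputable section Weighted

variable {K : Type u} [SmallCategory K] {M : Type*} [Category.{u} M]

/-- The `U`-weighted colimit functor `X ↦ U ⊗_K X`: the colimit of `X` over the pairs `(c, s)` with
`s : U(c)`, where a morphism `(c, s) ⟶ (c', s')` is `k : c ⟶ c'` with `U(k)(s') = s`. -/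
def weightedColim [HasColimits M] (U : Kᵒᵖ ⥤ Type u) : (K ⥤ M) ⥤ M :=
  (Functor.whiskeringLeft _ _ M).obj (CategoryOfElements.π U).leftOp ⋙ colim

/-- The `W`-weighted limit functor `X ↦ {W, X}_K`: the limit of `X` over the pairs `(c, t)` with
`t : W(c)`. -/
def weightedLim [HasLimits M] (W : K ⥤ Type u) : (K ⥤ M) ⥤ M :=
  (Functor.whiskeringLeft _ _ M).obj (CategoryOfElements.π W) ⋙ lim

section

variable [HasColimits M] {U : Kᵒᵖ ⥤ Type u} (X : K ⥤ M)

/-- The coprojection of the weighted colimit at `s : U(c)`. -/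
def weightedColimι {c : K} (s : U.obj (op c)) : X.obj c ⟶ (weightedColim U).obj X :=
  colimit.ι ((CategoryOfElements.π U).leftOp ⋙ X) (op (U.elementsMk (op c) s))

/-- Maps out of the weighted colimit. -/
def weightedColimDesc {Y : M} (φ : ∀ (c : K), U.obj (op c) → (X.obj c ⟶ Y))
    (h : ∀ {c c' : K} (k : c ⟶ c') (s : U.obj (op c')), X.map k ≫ φ c' s = φ c (U.map k.op s)) :
    (weightedColim U).obj X ⟶ Y :=
  colimit.desc ((CategoryOfElements.π U).leftOp ⋙ X)
    { pt := Y
      ι :=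
        { app := fun p => φ p.unop.1.unop p.unop.2
          naturality := fun p q k =>
            (h k.unop.1.unop q.unop.2).trans
              ((congrArg (φ p.unop.1.unop) k.unop.2).trans (Category.comp_id _).symm) } }

variable {X}

lemma weightedColimι_desc {Y : M} (φ : ∀ (c : K), U.obj (op c) → (X.obj c ⟶ Y))
    (h : ∀ {c c' : K} (k : c ⟶ c') (s : U.obj (op c')), X.map k ≫ φ c' s = φ c (U.map k.op s))
    {c : K} (s : U.obj (op c)) : weightedColimι X s ≫ weightedColimDesc X φ h = φ c s :=
  colimit.ι_desc _ _

lemma weightedColimι_map {X' : K ⥤ M} (f : X ⟶ X') {c : K} (s : U.obj (op c)) :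
    weightedColimι X s ≫ (weightedColim U).map f = f.app c ≫ weightedColimι X' s :=
  colimit.ι_map (Functor.whiskerLeft (CategoryOfElements.π U).leftOp f) _

lemma weightedColim_hom_ext {Y : M} {f g : (weightedColim U).obj X ⟶ Y}
    (h : ∀ (c : K) (s : U.obj (op c)), weightedColimι X s ≫ f = weightedColimι X s ≫ g) :
    f = g :=
  colimit.hom_ext (F := (CategoryOfElements.π U).leftOp ⋙ X) fun p => h p.unop.1.unop p.unop.2

end

section

variable [HasLimits M] {W : K ⥤ Type u} (X : K ⥤ M)

/-- The projection of the weighted limit at `t : W(c)`. -/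
def weightedLimπ {c : K} (t : W.obj c) : (weightedLim W).obj X ⟶ X.obj c :=
  limit.π (CategoryOfElements.π W ⋙ X) (W.elementsMk c t)

/-- Maps into the weighted limit. -/
def weightedLimLift {Y : M} (φ : ∀ (c : K), W.obj c → (Y ⟶ X.obj c))
    (h : ∀ {c c' : K} (k : c ⟶ c') (t : W.obj c), φ c t ≫ X.map k = φ c' (W.map k t)) :
    Y ⟶ (weightedLim W).obj X :=
  limit.lift (CategoryOfElements.π W ⋙ X)
    { pt := Y
      π :=
        { app := fun p => φ p.1 p.2
          naturality := fun p q k =>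
            (Category.id_comp _).trans
              ((congrArg (φ q.1) k.2).symm.trans (h k.1 p.2).symm) } }

variable {X}

lemma weightedLimLift_π {Y : M} (φ : ∀ (c : K), W.obj c → (Y ⟶ X.obj c))
    (h : ∀ {c c' : K} (k : c ⟶ c') (t : W.obj c), φ c t ≫ X.map k = φ c' (W.map k t))
    {c : K} (t : W.obj c) : weightedLimLift X φ h ≫ weightedLimπ X t = φ c t :=
  limit.lift_π _ _

lemma weightedLim_map_π {X' : K ⥤ M} (f : X ⟶ X') {c : K} (t : W.obj c) :
    (weightedLim W).map f ≫ weightedLimπ X' t = weightedLimπ X t ≫ f.app c :=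
  limMap_π (Functor.whiskerLeft (CategoryOfElements.π W) f) _

lemma weightedLim_hom_ext {Y : M} {f g : Y ⟶ (weightedLim W).obj X}
    (h : ∀ (c : K) (t : W.obj c), f ≫ weightedLimπ X t = g ≫ weightedLimπ X t) :
    f = g :=
  limit.hom_ext (F := CategoryOfElements.π W ⋙ X) fun p => h p.1 p.2

end

end Weighted

/-! ## Latching and matching objects, Reedy classes of maps -/

noncomputable section Reedy

variable {C : Type u} [SmallCategory C] (deg : C → Ordinal.{v}) {M : Type*} [Category.{u} M]

/-- The latching object functor `L_x A = C(-, x) ⊗ A`, over the objects of degree `< deg x`. -/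
def latching [HasColimits M] (x : C) : (C ⥤ M) ⥤ M :=
  (Functor.whiskeringLeft _ _ M).obj (degLT deg (deg x)).ι ⋙
    weightedColim ((degLT deg (deg x)).ι.op ⋙ yoneda.obj x)

/-- The canonical map `L_x A ⟶ A_x`, whose component at `f : c ⟶ x` is `A f`. -/
def latchingMap [HasColimits M] (x : C) : latching deg x ⟶ (evaluation C M).obj x where
  app A := weightedColimDesc (U := (degLT deg (deg x)).ι.op ⋙ yoneda.obj x)
    ((degLT deg (deg x)).ι ⋙ A) (fun c f => A.map (X := c.obj) (Y := x) f)
    (fun k f => (A.map_comp k.hom f).symm)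
  naturality A B f := by
    apply weightedColim_hom_ext
    intro c s
    dsimp only [latching, Functor.comp_map, Functor.whiskeringLeft_obj_map, evaluation_obj_map]
    erw [reassoc_of% (weightedColimι_map (U := (degLT deg (deg x)).ι.op ⋙ yoneda.obj x)
      ((degLT deg (deg x)).ι.whiskerLeft f) s), weightedColimι_desc,
      reassoc_of% (weightedColimι_desc (U := (degLT deg (deg x)).ι.op ⋙ yoneda.obj x)
        (X := (degLT deg (deg x)).ι ⋙ A))]
    exact (f.naturality (X := c.obj) (Y := x) s).symm

/-- The matching object functor `M_x A = {C(x, -), A}`, over the objects of degree `< deg x`. -/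
def matching [HasLimits M] (x : C) : (C ⥤ M) ⥤ M :=
  (Functor.whiskeringLeft _ _ M).obj (degLT deg (deg x)).ι ⋙
    weightedLim ((degLT deg (deg x)).ι ⋙ coyoneda.obj (op x))

/-- The canonical map `A_x ⟶ M_x A`, whose component at `f : x ⟶ c` is `A f`. -/
def matchingMap [HasLimits M] (x : C) : (evaluation C M).obj x ⟶ matching deg x where
  app A := weightedLimLift (W := (degLT deg (deg x)).ι ⋙ coyoneda.obj (op x))
    ((degLT deg (deg x)).ι ⋙ A) (fun c f => A.map (X := x) (Y := c.obj) f)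
    (fun k f => (A.map_comp f k.hom).symm)
  naturality A B f := by
    apply weightedLim_hom_ext
    intro c s
    dsimp only [matching, Functor.comp_map, Functor.whiskeringLeft_obj_map, evaluation_obj_map]
    rw [Category.assoc, Category.assoc]
    erw [weightedLim_map_π, weightedLimLift_π, reassoc_of% (weightedLimLift_π
      (W := (degLT deg (deg x)).ι ⋙ coyoneda.obj (op x)) (X := (degLT deg (deg x)).ι ⋙ A))]
    exact (f.naturality (X := x) (Y := c.obj) s).symm

/-- The relative latching map `L_x B ⊔_{L_x A} A_x ⟶ B_x` of `f : A ⟶ B`. -/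
def relLatchingMap [HasColimits M] {A B : C ⥤ M} (f : A ⟶ B) (x : C) :
    pushout ((latching deg x).map f) ((latchingMap deg x).app A) ⟶ B.obj x :=
  pushout.desc ((latchingMap deg x).app B) (f.app x) ((latchingMap deg x).naturality f)

/-- The relative matching map `A_x ⟶ M_x A ×_{M_x B} B_x` of `f : A ⟶ B`. -/
def relMatchingMap [HasLimits M] {A B : C ⥤ M} (f : A ⟶ B) (x : C) :
    A.obj x ⟶ pullback ((matching deg x).map f) ((matchingMap deg x).app B) :=
  pullback.lift ((matchingMap deg x).app A) (f.app x) ((matchingMap deg x).naturality f).symm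

/-- The left class of the Reedy weak factorization system on `C ⥤ M` induced by a weak
factorization system on `M` with left class `L`. -/
def reedyLeft [HasColimits M] (L : MorphismProperty M) : MorphismProperty (C ⥤ M) :=
  fun _ _ f => ∀ x, L (relLatchingMap deg f x)

/-- The right class of the Reedy weak factorization system on `C ⥤ M` induced by a weak
factorization system on `M` with right class `R`. -/
def reedyRight [HasLimits M] (R : MorphismProperty M) : MorphismProperty (C ⥤ M) :=
  fun _ _ f => ∀ x, R (relMatchingMap deg f x)

end Reedy

/-! ## Weak factorization systems and model structures -/

section Model

variable {E : Type*} [Category* E]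

/-- `X` is an `L`-object if `∅ ⟶ X` is an `L`-map. -/
def IsLeftObject [HasInitial E] (L : MorphismProperty E) (X : E) : Prop := L (initial.to X)

/-- The pairs of classes `(L₁, R₁)` and `(L₂, R₂)` are the two weak factorization systems
(acyclic cofibrations, fibrations) and (cofibrations, acyclic fibrations) of a model structure
with class of weak equivalences `we`. -/
structure FormModelStructure (L₁ R₁ L₂ R₂ we : MorphismProperty E) : Prop where
  wfs₁ : IsWeakFactorizationSystem L₁ R₁
  wfs₂ : IsWeakFactorizationSystem L₂ R₂
  left_eq : L₁ = L₂ ⊓ we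
  right_eq : R₂ = R₁ ⊓ we
  twoOutOfThree : we.HasTwoOutOfThreeProperty

/-- The maps all of whose pushouts are in `P`. (Mathlib's `MorphismProperty.universally` is the
dual notion, for pullbacks.) -/
def couniversally (P : MorphismProperty E) : MorphismProperty E := fun X Y f =>
  ∀ ⦃X' Y' : E⦄ (g : X ⟶ X') (g' : Y ⟶ Y') (f' : X' ⟶ Y'), IsPushout f g g' f' → P f'

end Model

/-- The injections: the left class of the weak factorization system (injections, surjections) on
the category of sets. -/
def injections : MorphismProperty (Type u) := fun _ _ f => Function.Injective f

/-! ## The model structure on sets whose homotopy category is the two-element poset -/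

/-! Both `L`-object conditions say that the latching maps of the weight are injective
(`isLeftObject_iff_latchingInjective`). In each part, one implication comes from an adjunction and
the other from a single, very coarse model structure on sets.

Sufficiency. The functor `U ⊗ -` is left adjoint to `X ↦ X ^ U`, the functor of powers. The matching
map of `X ^ U` at `x` is `X ^ U(x) ⟶ X ^ (L_x U)`, restriction along the latching map of `U`. When
that map is injective, a lifting problem against the relative matching map of `p ^ U` splits into
independent problems against `p`, one for each element of `U(x)` outside the image of `L_x U`; on
the image the answer is prescribed. Hence powers take fibrations to Reedy fibrations
(`hasLiftingProperty_relMatchingMap_powersMap`), and by adjunction `U ⊗ -` takes Reedy acyclic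
cofibrations to acyclic cofibrations, all of whose pushouts are weak equivalences. Dually, `{W, -}`
is right adjoint to `K ↦ W · K`, and copowers take cofibrations to Reedy cofibrations.

Necessity. Take sets with injections as cofibrations, and with the maps between two empty or two
nonempty sets as weak equivalences. An element of `{W, B}` is a natural transformation `W ⟶ B`, and
its fibre in `{W, A}` is its set of lifts to `A`. If `{W, f}` is a universal weak equivalence, every
such fibre is nonempty. So `∅ ⟶ W` lifts against all Reedy acyclic fibrations, and is therefore a
Reedy cofibration. For part 1 the same argument is run in the opposite category, where `U ⊗ A` is
the set of maps `A ⟶ U.rightOp`, so that `U.rightOp` is Reedy fibrant. -/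

lemma hasLiftingProperty_of_injective {A B X Y : Type u} (i : A ⟶ B) (p : X ⟶ Y)
    (hi : Function.Injective i) (hp : ∀ (_ : B) (_ : A → X), Function.Surjective p) :
    HasLiftingProperty i p := ⟨fun {f g} sq => by
  have w (a : A) : p (f a) = g (i a) := ConcreteCategory.congr_hom sq.w a
  -- Surjectivity of `p` is assumed only given a point of `B` and a map `A ⟶ X`. Both are at hand
  -- wherever a value has to be chosen, and they are what makes one argument serve both lifting
  -- axioms below.
  have (b : B) : ∃ x : X, p x = g b ∧ ∀ a, i a = b → x = f a := by
    by_cases hb : ∃ a, i a = b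
    · obtain ⟨a, rfl⟩ := hb
      exact ⟨f a, w a, fun a' h => by rw [hi h]⟩
    · obtain ⟨x, hx⟩ := hp b f (g b)
      exact ⟨x, hx, fun a h => (hb ⟨a, h⟩).elim⟩
  choose l hl₁ hl₂ using this
  exact ⟨⟨{ l := ↾l
            fac_left := by ext a; exact hl₂ _ a rfl
            fac_right := by ext b; exact hl₁ b }⟩⟩⟩

/-- The model structure on the category of sets in which the cofibrations are the injections and a
map is a weak equivalence if its source and its target are both empty or both nonempty. The acyclic
fibrations are the surjections. -/
@[reducible]
def nonemptinessModelCategory : ModelCategory (Type u) where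
  -- A map with empty source must be a fibration, since an acyclic cofibration into a nonempty set
  -- has nonempty source and so admits no map to the empty set.
  categoryWithFibrations := ⟨fun X _ p => Nonempty X → Function.Surjective p⟩
  categoryWithCofibrations := ⟨injections⟩
  -- The converse implication is automatic, because there is a map from `X` to `Y`.
  categoryWithWeakEquivalences := ⟨fun X Y _ => Nonempty Y → Nonempty X⟩
  cm2 :=
    { comp_mem := fun _ _ hf hg h => hf (hg h)
      of_postcomp := fun _ g _ hfg ⟨y⟩ => hfg ⟨g y⟩
      of_precomp := fun f _ _ hfg h => (hfg h).map f }
  cm3a := ⟨fun h hg ⟨b⟩ => (hg ⟨h.i.right b⟩).map h.r.left⟩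
  cm3b := ⟨fun {X Y Z W f g} h hg ⟨a⟩ b => by
    obtain ⟨z, hz⟩ := hg ⟨h.i.left a⟩ (h.i.right b)
    have h₁ : f (h.r.left z) = h.r.right (g z) := ConcreteCategory.congr_hom h.r.w z
    have h₂ : h.r.right (h.i.right b) = b := ConcreteCategory.congr_hom h.retract_right b
    exact ⟨h.r.left z, by rw [h₁, hz, h₂]⟩⟩
  cm3c := ⟨fun {X Y Z W f g} h hg a b hab => by
    have h₁ (a : X) : g (h.i.left a) = h.i.right (f a) := ConcreteCategory.congr_hom h.i.w a
    have h₂ (a : X) : h.r.left (h.i.left a) = a := ConcreteCategory.congr_hom h.retract_left a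
    rw [← h₂ a, ← h₂ b]
    exact congrArg h.r.left (hg (by rw [h₁, h₁, hab]))⟩
  cm4a i p hi₁ hi₂ hp := hasLiftingProperty_of_injective i p hi₁.mem
    fun b f => hp.mem ((hi₂.mem ⟨b⟩).map f)
  cm4b i p hi hp₁ hp₂ := hasLiftingProperty_of_injective i p hi.mem
    fun _ _ y => hp₁.mem (hp₂.mem ⟨y⟩) y
  cm5a := ⟨fun {X Y} f => by
    -- The coprojection into `X ⊕ Y` is acyclic only if `X` is nonempty or `Y` is empty; when `X` is
    -- empty, `f` is itself a fibration.
    by_cases hX : Nonempty X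
    · exact ⟨{
        Z := X ⊕ Y
        i := ↾Sum.inl
        p := ↾Sum.elim f id
        fac := rfl
        hi := ⟨Sum.inl_injective, fun _ => hX⟩
        hp := fun _ y => ⟨Sum.inr y, rfl⟩ }⟩
    · exact ⟨{
        Z := X
        i := 𝟙 X
        p := f
        hi := ⟨Function.injective_id, id⟩
        hp := fun h => (hX h).elim }⟩⟩
  cm5b := ⟨fun {X Y} f => ⟨{
    Z := X ⊕ Y
    i := ↾Sum.inl
    p := ↾Sum.elim f id
    fac := rfl
    hi := Sum.inl_injective
    hp := ⟨fun _ y => ⟨Sum.inr y, rfl⟩, fun ⟨y⟩ => ⟨Sum.inr y⟩⟩ }⟩⟩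

/-! ## Latching objects of set-valued functors -/

section Latching

variable {C : Type u} [SmallCategory C] (deg : C → Ordinal.{v})

/-- The latching maps `L_x W ⟶ W_x` are injective, formulated without choosing the colimits
`L_x W`: a map out of `L_x W`, given by a compatible family `φ`, identifies any two elements that
have the same image in `W_x`. -/
def LatchingInjective (W : C ⥤ Type u) : Prop :=
  ∀ (x : C) (T : Type u) (φ : ∀ c : C, deg c < deg x → (c ⟶ x) → W.obj c → T),
    (∀ (c c' : C) (hc : deg c < deg x) (hc' : deg c' < deg x) (k : c ⟶ c') (f : c' ⟶ x)
      (w : W.obj c), φ c hc (k ≫ f) w = φ c' hc' f (W.map k w)) →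
    ∀ (c c' : C) (hc : deg c < deg x) (hc' : deg c' < deg x) (f : c ⟶ x) (f' : c' ⟶ x)
      (w : W.obj c) (w' : W.obj c'), W.map f w = W.map f' w' → φ c hc f w = φ c' hc' f' w'

variable {K : Type u} [SmallCategory K] {M : Type*} [Category.{u} M]

lemma map_weightedColimι [HasColimits M] {U : Kᵒᵖ ⥤ Type u} (X : K ⥤ M) {c c' : K} (k : c ⟶ c')
    (s : U.obj (op c')) :
    X.map k ≫ weightedColimι X s = weightedColimι X (U.map k.op s) :=
  colimit.w ((CategoryOfElements.π U).leftOp ⋙ X)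
    (Quiver.Hom.op (CategoryOfElements.homMk (U.elementsMk (op c') s)
      (U.elementsMk (op c) (U.map k.op s)) k.op rfl))

lemma weightedLimπ_map [HasLimits M] {W : K ⥤ Type u} (X : K ⥤ M) {c c' : K} (k : c ⟶ c')
    (t : W.obj c) :
    weightedLimπ X t ≫ X.map k = weightedLimπ X (W.map k t) :=
  limit.w (CategoryOfElements.π W ⋙ X)
    (CategoryOfElements.homMk (W.elementsMk c t) (W.elementsMk c' (W.map k t)) k rfl)

/-! ### Relative latching objects by generators and relations -/

section Colim

variable [HasColimits M] {deg} (A : C ⥤ M) {x : C}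

/-- The coprojection of the latching object `L_x A` at `f : c ⟶ x`. -/
noncomputable def latchingι {c : C} (hc : deg c < deg x) (f : c ⟶ x) :
    A.obj c ⟶ (latching deg x).obj A :=
  weightedColimι (U := (degLT deg (deg x)).ι.op ⋙ yoneda.obj x)
    ((degLT deg (deg x)).ι ⋙ A) (c := ⟨c, hc⟩) f

/-- Maps out of the latching object. -/
noncomputable def latchingDesc {Y : M} (φ : ∀ c : C, deg c < deg x → (c ⟶ x) → (A.obj c ⟶ Y))
    (h : ∀ (c c' : C) (hc : deg c < deg x) (hc' : deg c' < deg x) (k : c ⟶ c') (f : c' ⟶ x),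
      A.map k ≫ φ c' hc' f = φ c hc (k ≫ f)) :
    (latching deg x).obj A ⟶ Y :=
  weightedColimDesc (U := (degLT deg (deg x)).ι.op ⋙ yoneda.obj x)
    ((degLT deg (deg x)).ι ⋙ A) (fun c f => φ c.obj c.property f) (fun k f => h _ _ _ _ k.hom f)

variable {A}

lemma latchingι_desc {Y : M} (φ : ∀ c : C, deg c < deg x → (c ⟶ x) → (A.obj c ⟶ Y))
    (h : ∀ (c c' : C) (hc : deg c < deg x) (hc' : deg c' < deg x) (k : c ⟶ c') (f : c' ⟶ x),
      A.map k ≫ φ c' hc' f = φ c hc (k ≫ f)) {c : C} (hc : deg c < deg x) (f : c ⟶ x) :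
    latchingι A hc f ≫ latchingDesc A φ h = φ c hc f :=
  weightedColimι_desc (U := (degLT deg (deg x)).ι.op ⋙ yoneda.obj x)
    (X := (degLT deg (deg x)).ι ⋙ A) (fun c f => φ c.obj c.property f)
    (fun k f => h _ _ _ _ k.hom f) (c := ⟨c, hc⟩) f

lemma latchingι_latchingMap {c : C} (hc : deg c < deg x) (f : c ⟶ x) :
    latchingι A hc f ≫ (latchingMap deg x).app A = A.map f :=
  latchingι_desc (fun _ _ f => A.map f) (fun _ _ _ _ k f => (A.map_comp k f).symm) hc f

lemma latchingι_map {B : C ⥤ M} (g : A ⟶ B) {c : C} (hc : deg c < deg x) (f : c ⟶ x) :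
    latchingι A hc f ≫ (latching deg x).map g = g.app c ≫ latchingι B hc f :=
  weightedColimι_map (U := (degLT deg (deg x)).ι.op ⋙ yoneda.obj x)
    (X := (degLT deg (deg x)).ι ⋙ A) ((degLT deg (deg x)).ι.whiskerLeft g) (c := ⟨c, hc⟩) f

lemma map_latchingι {c c' : C} (hc : deg c < deg x) (hc' : deg c' < deg x) (k : c ⟶ c')
    (f : c' ⟶ x) : A.map k ≫ latchingι A hc' f = latchingι A hc (k ≫ f) :=
  map_weightedColimι (U := (degLT deg (deg x)).ι.op ⋙ yoneda.obj x)
    ((degLT deg (deg x)).ι ⋙ A) (c := ⟨c, hc⟩) (c' := ⟨c', hc'⟩) ⟨k⟩ f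

lemma latching_hom_ext {Y : M} {g g' : (latching deg x).obj A ⟶ Y}
    (h : ∀ (c : C) (hc : deg c < deg x) (f : c ⟶ x),
      latchingι A hc f ≫ g = latchingι A hc f ≫ g') : g = g' :=
  weightedColim_hom_ext (U := (degLT deg (deg x)).ι.op ⋙ yoneda.obj x)
    (X := (degLT deg (deg x)).ι ⋙ A) fun c f => h c.obj c.property f

section Relative

variable (deg) {A B : C ⥤ M} (g : A ⟶ B) (x : C)

/-- The source `L_x B ⊔_{L_x A} A_x` of the relative latching map. -/
noncomputable abbrev relLatching : M :=
  pushout ((latching deg x).map g) ((latchingMap deg x).app A)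

/-- The coprojection of `L_x B ⊔_{L_x A} A_x` at `f : c ⟶ x`. -/
noncomputable def relLatchingInl {c : C} (hc : deg c < deg x) (f : c ⟶ x) :
    B.obj c ⟶ relLatching deg g x :=
  latchingι B hc f ≫ pushout.inl _ _

/-- The coprojection `A_x ⟶ L_x B ⊔_{L_x A} A_x`. -/
noncomputable def relLatchingInr : A.obj x ⟶ relLatching deg g x :=
  pushout.inr ((latching deg x).map g) ((latchingMap deg x).app A)

variable {deg x}

lemma map_relLatchingInl {c c' : C} (hc : deg c < deg x) (hc' : deg c' < deg x) (k : c ⟶ c')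
    (f : c' ⟶ x) :
    B.map k ≫ relLatchingInl deg g x hc' f = relLatchingInl deg g x hc (k ≫ f) := by
  rw [relLatchingInl, reassoc_of% (map_latchingι (A := B) hc hc'), relLatchingInl]

lemma app_relLatchingInl {c : C} (hc : deg c < deg x) (f : c ⟶ x) :
    g.app c ≫ relLatchingInl deg g x hc f = A.map f ≫ relLatchingInr deg g x := by
  rw [relLatchingInl, ← reassoc_of% latchingι_map, pushout.condition]
  exact (reassoc_of% (latchingι_latchingMap (A := A) hc f)) _

lemma relLatchingInl_relLatchingMap {c : C} (hc : deg c < deg x) (f : c ⟶ x) :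
    relLatchingInl deg g x hc f ≫ relLatchingMap deg g x = B.map f := by
  rw [relLatchingInl, relLatchingMap, Category.assoc, pushout.inl_desc]
  exact latchingι_latchingMap hc f

lemma relLatchingInr_relLatchingMap :
    relLatchingInr deg g x ≫ relLatchingMap deg g x = g.app x :=
  pushout.inr_desc _ _ _

variable {g}

lemma relLatching_hom_ext {Y : M} {a b : relLatching deg g x ⟶ Y}
    (h : ∀ (c : C) (hc : deg c < deg x) (f : c ⟶ x),
      relLatchingInl deg g x hc f ≫ a = relLatchingInl deg g x hc f ≫ b)
    (h' : relLatchingInr deg g x ≫ a = relLatchingInr deg g x ≫ b) : a = b :=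
  pushout.hom_ext (latching_hom_ext fun c hc f => by simpa [relLatchingInl] using h c hc f) h'

end Relative

end Colim

/-! ### Relative matching objects by projections -/

section Lim

variable [HasLimits M] {deg} (A : C ⥤ M) {x : C}

/-- The projection of the matching object `M_x A` at `f : x ⟶ c`. -/
noncomputable def matchingπ {c : C} (hc : deg c < deg x) (f : x ⟶ c) :
    (matching deg x).obj A ⟶ A.obj c :=
  weightedLimπ (W := (degLT deg (deg x)).ι ⋙ coyoneda.obj (op x))
    ((degLT deg (deg x)).ι ⋙ A) (c := ⟨c, hc⟩) f

/-- Maps into the matching object. -/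
noncomputable def matchingLift {Y : M} (φ : ∀ c : C, deg c < deg x → (x ⟶ c) → (Y ⟶ A.obj c))
    (h : ∀ (c c' : C) (hc : deg c < deg x) (hc' : deg c' < deg x) (k : c ⟶ c') (f : x ⟶ c),
      φ c hc f ≫ A.map k = φ c' hc' (f ≫ k)) :
    Y ⟶ (matching deg x).obj A :=
  weightedLimLift (W := (degLT deg (deg x)).ι ⋙ coyoneda.obj (op x))
    ((degLT deg (deg x)).ι ⋙ A) (fun c f => φ c.obj c.property f) (fun k f => h _ _ _ _ k.hom f)

variable {A}

lemma matchingLift_π {Y : M} (φ : ∀ c : C, deg c < deg x → (x ⟶ c) → (Y ⟶ A.obj c))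
    (h : ∀ (c c' : C) (hc : deg c < deg x) (hc' : deg c' < deg x) (k : c ⟶ c') (f : x ⟶ c),
      φ c hc f ≫ A.map k = φ c' hc' (f ≫ k)) {c : C} (hc : deg c < deg x) (f : x ⟶ c) :
    matchingLift A φ h ≫ matchingπ A hc f = φ c hc f :=
  weightedLimLift_π (W := (degLT deg (deg x)).ι ⋙ coyoneda.obj (op x))
    (X := (degLT deg (deg x)).ι ⋙ A) (fun c f => φ c.obj c.property f)
    (fun k f => h _ _ _ _ k.hom f) (c := ⟨c, hc⟩) f

lemma matchingMap_matchingπ {c : C} (hc : deg c < deg x) (f : x ⟶ c) :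
    (matchingMap deg x).app A ≫ matchingπ A hc f = A.map f :=
  matchingLift_π (fun _ _ f => A.map f) (fun _ _ _ _ k f => (A.map_comp f k).symm) hc f

lemma matching_map_π {B : C ⥤ M} (g : A ⟶ B) {c : C} (hc : deg c < deg x) (f : x ⟶ c) :
    (matching deg x).map g ≫ matchingπ B hc f = matchingπ A hc f ≫ g.app c :=
  weightedLim_map_π (W := (degLT deg (deg x)).ι ⋙ coyoneda.obj (op x))
    (X := (degLT deg (deg x)).ι ⋙ A) ((degLT deg (deg x)).ι.whiskerLeft g) (c := ⟨c, hc⟩) f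

lemma matchingπ_map {c c' : C} (hc : deg c < deg x) (hc' : deg c' < deg x) (k : c ⟶ c')
    (f : x ⟶ c) : matchingπ A hc f ≫ A.map k = matchingπ A hc' (f ≫ k) :=
  weightedLimπ_map (W := (degLT deg (deg x)).ι ⋙ coyoneda.obj (op x))
    ((degLT deg (deg x)).ι ⋙ A) (c := ⟨c, hc⟩) (c' := ⟨c', hc'⟩) ⟨k⟩ f

lemma matching_hom_ext {Y : M} {g g' : Y ⟶ (matching deg x).obj A}
    (h : ∀ (c : C) (hc : deg c < deg x) (f : x ⟶ c),
      g ≫ matchingπ A hc f = g' ≫ matchingπ A hc f) : g = g' :=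
  weightedLim_hom_ext (W := (degLT deg (deg x)).ι ⋙ coyoneda.obj (op x))
    (X := (degLT deg (deg x)).ι ⋙ A) fun c f => h c.obj c.property f

section Relative

variable (deg) {A B : C ⥤ M} (g : A ⟶ B) (x : C)

/-- The target `M_x A ×_{M_x B} B_x` of the relative matching map. -/
noncomputable abbrev relMatching : M :=
  pullback ((matching deg x).map g) ((matchingMap deg x).app B)

/-- The projection of `M_x A ×_{M_x B} B_x` at `f : x ⟶ c`. -/
noncomputable def relMatchingFst {c : C} (hc : deg c < deg x) (f : x ⟶ c) :
    relMatching deg g x ⟶ A.obj c :=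
  pullback.fst _ _ ≫ matchingπ A hc f

/-- The projection `M_x A ×_{M_x B} B_x ⟶ B_x`. -/
noncomputable def relMatchingSnd : relMatching deg g x ⟶ B.obj x :=
  pullback.snd ((matching deg x).map g) ((matchingMap deg x).app B)

variable {deg x}

lemma relMatchingFst_map {c c' : C} (hc : deg c < deg x) (hc' : deg c' < deg x) (k : c ⟶ c')
    (f : x ⟶ c) :
    relMatchingFst deg g x hc f ≫ A.map k = relMatchingFst deg g x hc' (f ≫ k) := by
  rw [relMatchingFst, Category.assoc, matchingπ_map hc hc', relMatchingFst]

lemma relMatchingFst_app {c : C} (hc : deg c < deg x) (f : x ⟶ c) :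
    relMatchingFst deg g x hc f ≫ g.app c = relMatchingSnd deg g x ≫ B.map f := by
  rw [relMatchingFst, Category.assoc, ← matching_map_π, pullback.condition_assoc]
  exact congrArg (relMatchingSnd deg g x ≫ ·) (matchingMap_matchingπ hc f)

lemma relMatchingMap_relMatchingFst {c : C} (hc : deg c < deg x) (f : x ⟶ c) :
    relMatchingMap deg g x ≫ relMatchingFst deg g x hc f = A.map f := by
  rw [relMatchingFst, relMatchingMap, pullback.lift_fst_assoc]
  exact matchingMap_matchingπ hc f

lemma relMatchingMap_relMatchingSnd :
    relMatchingMap deg g x ≫ relMatchingSnd deg g x = g.app x :=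
  pullback.lift_snd _ _ _

variable {g}

lemma relMatching_hom_ext {Y : M} {a b : Y ⟶ relMatching deg g x}
    (h : ∀ (c : C) (hc : deg c < deg x) (f : x ⟶ c),
      a ≫ relMatchingFst deg g x hc f = b ≫ relMatchingFst deg g x hc f)
    (h' : a ≫ relMatchingSnd deg g x = b ≫ relMatchingSnd deg g x) : a = b :=
  pullback.hom_ext (matching_hom_ext fun c hc f => by simpa [relMatchingFst] using h c hc f) h'

end Relative

end Lim
end Latching

/-! ### Reedy left objects for injections and surjections -/

section LeftObject

variable {C : Type u} [SmallCategory C] {deg : C → Ordinal.{v}}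

lemma latchingι_jointly_surjective {W : C ⥤ Type u} {x : C} (z : (latching deg x).obj W) :
    ∃ (c : C) (hc : deg c < deg x) (f : c ⟶ x) (w : W.obj c), latchingι W hc f w = z := by
  obtain ⟨j, w, hw⟩ := Types.jointly_surjective' (F := (CategoryOfElements.π
    ((degLT deg (deg x)).ι.op ⋙ yoneda.obj x)).leftOp ⋙ (degLT deg (deg x)).ι ⋙ W) z
  exact ⟨j.unop.1.unop.obj, j.unop.1.unop.property, j.unop.2, w, hw⟩

/-- The `L`-objects of the Reedy weak factorization system induced by (injections, surjections). -/
lemma isLeftObject_iff_latchingInjective (W : C ⥤ Type u) :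
    IsLeftObject (reedyLeft deg injections) W ↔ LatchingInjective deg W := by
  -- Colimits of functors are objectwise, so the values of the initial functor are empty and the
  -- relative latching map of `∅ ⟶ W` is in effect `L_x W ⟶ W_x`.
  have hempty (x : C) : IsInitial ((⊥_ (C ⥤ Type u)).obj x) :=
    IsInitial.isInitialObj ((evaluation C (Type u)).obj x) _ initialIsInitial
  have key {x c : C} (hc : deg c < deg x) (f : c ⟶ x) (w : W.obj c) :
      relLatchingMap deg (initial.to W) x (relLatchingInl deg (initial.to W) x hc f w) =
        W.map f w :=
    ConcreteCategory.congr_hom (relLatchingInl_relLatchingMap (initial.to W) hc f) w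
  constructor
  · intro h x T φ hφ c c' hc hc' f f' w w' e
    let d : (latching deg x).obj W ⟶ T := latchingDesc W (fun c hc f => ↾(φ c hc f))
      (fun c c' hc hc' k f => by ext w; exact (hφ c c' hc hc' k f w).symm)
    let q : relLatching deg (initial.to W) x ⟶ T :=
      pushout.desc d ((hempty x).to T) (latching_hom_ext fun c _ _ => (hempty c).hom_ext _ _)
    have hq {c : C} (hc : deg c < deg x) (f : c ⟶ x) (w : W.obj c) :
        q (relLatchingInl deg (initial.to W) x hc f w) = φ c hc f w := by
      have : relLatchingInl deg (initial.to W) x hc f ≫ q = ↾(φ c hc f) := by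
        rw [relLatchingInl, Category.assoc, pushout.inl_desc, latchingι_desc]
      exact ConcreteCategory.congr_hom this w
    rw [← hq, ← hq]
    exact congrArg q (h x (by rw [key, key, e]))
  · intro h x
    have hsurj (z : relLatching deg (initial.to W) x) :
        ∃ (c : C) (hc : deg c < deg x) (f : c ⟶ x) (w : W.obj c),
          z = relLatchingInl deg (initial.to W) x hc f w := by
      rcases Types.eq_or_eq_of_isPushout (IsPushout.of_hasPushout _ _) z with ⟨y, rfl⟩ | ⟨y, _⟩
      · obtain ⟨c, hc, f, w, rfl⟩ := latchingι_jointly_surjective y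
        exact ⟨c, hc, f, w, rfl⟩
      · exact ((hempty x).to PEmpty y).elim
    intro z z' e
    obtain ⟨c, hc, f, w, rfl⟩ := hsurj z
    obtain ⟨c', hc', f', w', rfl⟩ := hsurj z'
    rw [key, key] at e
    -- The test set is the relative latching object itself, with its tautological compatible family.
    refine h x _ (fun c hc f w => relLatchingInl deg (initial.to W) x hc f w) ?_
      c c' hc hc' f f' w w' e
    intro c c' hc hc' k f w
    exact (ConcreteCategory.congr_hom (map_relLatchingInl (initial.to W) hc hc' k f) w).symm

end LeftObject

/-! ## Powers and weighted colimits -/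

noncomputable section Powers

variable {C : Type u} [SmallCategory C] {deg : C → Ordinal.{v}} {M : Type*} [Category.{u} M]

section

variable [HasLimits M] (U : Cᵒᵖ ⥤ Type u)

/-- The functor of powers `c ↦ X ^ U(c)`. -/
def powers (X : M) : C ⥤ M where
  obj c := ∏ᶜ fun _ : U.obj (op c) => X
  map k := Pi.lift fun s => Pi.π _ (U.map k.op s)

variable {U}

/-- The projection `X ^ U(c) ⟶ X` at `s : U(c)`. -/
def powersπ (X : M) {c : C} (s : U.obj (op c)) : (powers U X).obj c ⟶ X :=
  Pi.π (fun _ : U.obj (op c) => X) s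

/-- Maps into `X ^ U(c)`. -/
def powersLift {X Y : M} {c : C} (φ : U.obj (op c) → (Y ⟶ X)) : Y ⟶ (powers U X).obj c :=
  Pi.lift φ

@[simp]
lemma powersLift_π {X Y : M} {c : C} (φ : U.obj (op c) → (Y ⟶ X)) (s : U.obj (op c)) :
    powersLift φ ≫ powersπ X s = φ s :=
  Limits.Pi.lift_π _ _

@[simp]
lemma powers_map_π (X : M) {c c' : C} (k : c ⟶ c') (s : U.obj (op c')) :
    (powers U X).map k ≫ powersπ X s = powersπ X (U.map k.op s) :=
  Limits.Pi.lift_π _ _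

lemma powers_hom_ext {X Y : M} {c : C} {f g : Y ⟶ (powers U X).obj c}
    (h : ∀ s, f ≫ powersπ X s = g ≫ powersπ X s) : f = g :=
  Pi.hom_ext _ _ h

variable (U)

/-- The map `X ^ U ⟶ Y ^ U` induced by `X ⟶ Y`. -/
def powersMap {X Y : M} (p : X ⟶ Y) : powers U X ⟶ powers U Y where
  app _ := powersLift fun s => powersπ X s ≫ p
  naturality _ _ _ := powers_hom_ext fun s => by simp [reassoc_of% powers_map_π]

variable {U}

@[simp]
lemma powersMap_app_π {X Y : M} (p : X ⟶ Y) {c : C} (s : U.obj (op c)) :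
    (powersMap U p).app c ≫ powersπ Y s = powersπ X s ≫ p :=
  powersLift_π _ _

/-- Transposition along the adjunction between `U ⊗ -` and `X ↦ X ^ U`: a map `U ⊗ A ⟶ X` and a map
`A ⟶ X ^ U` are both natural families `A_c ⟶ X` indexed by `s : U(c)`. The square is transposed,
lifted, and the lift transposed back. -/
lemma hasLiftingProperty_weightedColim_map [HasColimits M] {A B : C ⥤ M} (f : A ⟶ B) {X Y : M}
    (p : X ⟶ Y) [HasLiftingProperty f (powersMap U p)] :
    HasLiftingProperty ((weightedColim U).map f) p := ⟨fun {a b} sq => by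
  let a' : A ⟶ powers U X :=
    { app := fun c => powersLift fun s => weightedColimι A s ≫ a
      naturality := fun c c' k => powers_hom_ext fun s => by
        simp [← map_weightedColimι] }
  let b' : B ⟶ powers U Y :=
    { app := fun c => powersLift fun s => weightedColimι B s ≫ b
      naturality := fun c c' k => powers_hom_ext fun s => by
        simp [← map_weightedColimι] }
  have sq' : CommSq a' f (powersMap U p) b' := ⟨by
    ext c
    refine powers_hom_ext fun s => ?_
    simp [a', b', sq.w, reassoc_of% weightedColimι_map, reassoc_of% powersLift_π]⟩
  have h₁ (c : C) (s : U.obj (op c)) :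
      f.app c ≫ sq'.lift.app c ≫ powersπ X s = weightedColimι A s ≫ a := by
    rw [← NatTrans.comp_app_assoc, sq'.fac_left]
    simp [a']
  have h₂ (c : C) (s : U.obj (op c)) :
      sq'.lift.app c ≫ powersπ X s ≫ p = weightedColimι B s ≫ b := by
    rw [← powersMap_app_π, ← NatTrans.comp_app_assoc, sq'.fac_right]
    simp [b']
  have h₃ {c c' : C} (k : c ⟶ c') (s : U.obj (op c')) :
      B.map k ≫ sq'.lift.app c' ≫ powersπ X s = sq'.lift.app c ≫ powersπ X (U.map k.op s) := by
    simp
  refine ⟨⟨{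
    l := weightedColimDesc B (fun c s => sq'.lift.app c ≫ powersπ X s) h₃
    fac_left := weightedColim_hom_ext fun c s => ?_
    fac_right := weightedColim_hom_ext fun c s => ?_ }⟩⟩
  · rw [reassoc_of% weightedColimι_map, weightedColimι_desc, h₁]
  · rw [reassoc_of% (weightedColimι_desc (X := B) _ h₃), h₂]⟩

/-- A lift `L ⟶ X ^ U(x)` is a family of maps `L ⟶ X` indexed by `U(x)`. At elements coming from
lower degree the component is dictated by the matching object, unambiguously since the latching map
of `U` is injective; at each other element any lift of `i` against `p` will do. -/
lemma hasLiftingProperty_relMatchingMap_powersMap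
    (hU : LatchingInjective (fun x : Cᵒᵖ => deg x.unop) U) {K L X Y : M} (i : K ⟶ L) (p : X ⟶ Y)
    [HasLiftingProperty i p] (x : C) :
    HasLiftingProperty i (relMatchingMap deg (powersMap U p) x) := ⟨fun {a b} sq => by
  let φ (c : Cᵒᵖ) (hc : deg c.unop < deg x) (f : c ⟶ op x) (s : U.obj c) : L ⟶ X :=
    b ≫ relMatchingFst deg (powersMap U p) x hc f.unop ≫ powersπ X s
  -- With the hom-set `L ⟶ X` as test set, latching injectivity says that the prescribed map `φ c hc
  -- f s` depends only on the element `U.map f s` of `U(x)`.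
  have hφ := hU (op x) (L ⟶ X) φ (fun c c' hc hc' k f s => by
    simp only [φ, unop_comp, ← relMatchingFst_map _ hc' hc, Category.assoc, powers_map_π]
    rfl)
  have wl (c : Cᵒᵖ) (hc : deg c.unop < deg x) (f : c ⟶ op x) (s : U.obj c) :
      i ≫ φ c hc f s = a ≫ powersπ X (U.map f s) := by
    simp only [φ, ← sq.w_assoc, reassoc_of% relMatchingMap_relMatchingFst, powers_map_π]
    rfl
  have wr (c : Cᵒᵖ) (hc : deg c.unop < deg x) (f : c ⟶ op x) (s : U.obj c) :
      φ c hc f s ≫ p = b ≫ relMatchingSnd deg (powersMap U p) x ≫ powersπ Y (U.map f s) := by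
    simp only [φ, Category.assoc, ← powersMap_app_π, reassoc_of% relMatchingFst_app, powers_map_π]
    rfl
  have (s : U.obj (op x)) : ∃ l : L ⟶ X, i ≫ l = a ≫ powersπ X s ∧
      l ≫ p = b ≫ relMatchingSnd deg (powersMap U p) x ≫ powersπ Y s ∧
      ∀ (c : Cᵒᵖ) (hc : deg c.unop < deg x) (f : c ⟶ op x) (t : U.obj c), U.map f t = s →
        l = φ c hc f t := by
    by_cases hs : ∃ (c : Cᵒᵖ) (_ : deg c.unop < deg x) (f : c ⟶ op x) (t : U.obj c), U.map f t = s
    · obtain ⟨c, hc, f, t, rfl⟩ := hs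
      exact ⟨φ c hc f t, wl c hc f t, wr c hc f t, fun c' hc' f' t' e =>
        hφ c c' hc hc' f f' t t' e.symm⟩
    · have sq' : CommSq (a ≫ powersπ X s) i p
          (b ≫ relMatchingSnd deg (powersMap U p) x ≫ powersπ Y s) := ⟨by
        rw [← sq.w_assoc, reassoc_of% relMatchingMap_relMatchingSnd, powersMap_app_π,
          Category.assoc]⟩
      exact ⟨sq'.lift, sq'.fac_left, sq'.fac_right, fun c hc f t e => (hs ⟨c, hc, f, t, e⟩).elim⟩
  choose l hl₁ hl₂ hl₃ using this
  refine ⟨⟨{ l := powersLift l, fac_left := ?_, fac_right := ?_ }⟩⟩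
  · exact powers_hom_ext fun s => by rw [Category.assoc, powersLift_π, hl₁]
  · refine relMatching_hom_ext (fun c hc f => powers_hom_ext fun s => ?_)
      (powers_hom_ext fun s => ?_)
    · simp only [Category.assoc, reassoc_of% relMatchingMap_relMatchingFst, powers_map_π,
        powersLift_π]
      -- This is where the prescribed values matter: they make the matching components of the lift
      -- agree with those of `b`.
      exact hl₃ _ (op c) hc f.op s rfl
    · simp only [Category.assoc, reassoc_of% relMatchingMap_relMatchingSnd, powersMap_app_π,
        reassoc_of% powersLift_π, hl₂]⟩

end

/-! ## Copowers and weighted limits -/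

section

variable [HasColimits M] (W : C ⥤ Type u)

/-- The functor of copowers `c ↦ W(c) · K`. -/
def copowers (K : M) : C ⥤ M where
  obj c := ∐ fun _ : W.obj c => K
  map k := Sigma.desc fun t => Sigma.ι (fun _ => K) (W.map k t)

variable {W}

/-- The coprojection `K ⟶ W(c) · K` at `t : W(c)`. -/
def copowersι (K : M) {c : C} (t : W.obj c) : K ⟶ (copowers W K).obj c :=
  Sigma.ι (fun _ : W.obj c => K) t

/-- Maps out of `W(c) · K`. -/
def copowersDesc {K Y : M} {c : C} (φ : W.obj c → (K ⟶ Y)) : (copowers W K).obj c ⟶ Y :=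
  Sigma.desc φ

@[simp]
lemma copowersι_desc {K Y : M} {c : C} (φ : W.obj c → (K ⟶ Y)) (t : W.obj c) :
    copowersι K t ≫ copowersDesc φ = φ t :=
  Limits.Sigma.ι_desc _ _

@[simp]
lemma copowersι_map (K : M) {c c' : C} (k : c ⟶ c') (t : W.obj c) :
    copowersι K t ≫ (copowers W K).map k = copowersι K (W.map k t) :=
  Limits.Sigma.ι_desc _ _

lemma copowers_hom_ext {K Y : M} {c : C} {f g : (copowers W K).obj c ⟶ Y}
    (h : ∀ t, copowersι K t ≫ f = copowersι K t ≫ g) : f = g :=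
  Sigma.hom_ext _ _ h

variable (W)

/-- The map `W · K ⟶ W · L` induced by `K ⟶ L`. -/
def copowersMap {K L : M} (i : K ⟶ L) : copowers W K ⟶ copowers W L where
  app _ := copowersDesc fun t => i ≫ copowersι L t
  naturality _ _ _ := copowers_hom_ext fun t => by
    simp [reassoc_of% copowersι_map, reassoc_of% copowersι_desc]

variable {W}

@[simp]
lemma copowersι_copowersMap_app {K L : M} (i : K ⟶ L) {c : C} (t : W.obj c) :
    copowersι K t ≫ (copowersMap W i).app c = i ≫ copowersι L t :=
  copowersι_desc _ _

/-- Transposition along the adjunction between `K ↦ W · K` and `{W, -}`. -/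
lemma hasLiftingProperty_weightedLim_map [HasLimits M] {A B : C ⥤ M} (f : A ⟶ B) {K L : M}
    (i : K ⟶ L) [HasLiftingProperty (copowersMap W i) f] :
    HasLiftingProperty i ((weightedLim W).map f) := ⟨fun {a b} sq => by
  let a' : copowers W K ⟶ A :=
    { app := fun c => copowersDesc fun t => a ≫ weightedLimπ A t
      naturality := fun c c' k => copowers_hom_ext fun t => by
        simp [weightedLimπ_map, reassoc_of% copowersι_map, reassoc_of% copowersι_desc] }
  let b' : copowers W L ⟶ B :=
    { app := fun c => copowersDesc fun t => b ≫ weightedLimπ B t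
      naturality := fun c c' k => copowers_hom_ext fun t => by
        simp [weightedLimπ_map, reassoc_of% copowersι_map, reassoc_of% copowersι_desc] }
  have sq' : CommSq a' (copowersMap W i) f b' := ⟨by
    ext c
    refine copowers_hom_ext fun t => ?_
    simp [a', b', ← sq.w_assoc, weightedLim_map_π, reassoc_of% copowersι_desc,
      reassoc_of% copowersι_copowersMap_app]⟩
  have h₁ (c : C) (t : W.obj c) :
      copowersι L t ≫ sq'.lift.app c ≫ f.app c = b ≫ weightedLimπ B t := by
    rw [← NatTrans.comp_app, sq'.fac_right]
    simp [b']
  have h₂ (c : C) (t : W.obj c) :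
      i ≫ copowersι L t ≫ sq'.lift.app c = a ≫ weightedLimπ A t := by
    rw [← reassoc_of% copowersι_copowersMap_app, ← NatTrans.comp_app, sq'.fac_left]
    simp [a']
  have h₃ {c c' : C} (k : c ⟶ c') (t : W.obj c) :
      (copowersι L t ≫ sq'.lift.app c) ≫ A.map k =
        copowersι L (W.map k t) ≫ sq'.lift.app c' := by
    simp [← NatTrans.naturality, reassoc_of% copowersι_map]
  refine ⟨⟨{
    l := weightedLimLift A (fun c t => copowersι L t ≫ sq'.lift.app c) h₃
    fac_left := weightedLim_hom_ext fun c t => ?_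
    fac_right := weightedLim_hom_ext fun c t => ?_ }⟩⟩
  · rw [Category.assoc, weightedLimLift_π, h₂]
  · rw [Category.assoc, weightedLim_map_π, reassoc_of% (weightedLimLift_π (X := A) _ h₃), h₁]⟩

/-- Dual to the case of powers: a map `W(x) · L ⟶ X` is a family indexed by `W(x)`, prescribed on
the image of `L_x W` and chosen freely, by lifting `i` against `p`, elsewhere. -/
lemma hasLiftingProperty_relLatchingMap_copowersMap
    (hW : LatchingInjective deg W) {K L X Y : M} (i : K ⟶ L) (p : X ⟶ Y)
    [HasLiftingProperty i p] (x : C) :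
    HasLiftingProperty (relLatchingMap deg (copowersMap W i) x) p := ⟨fun {a b} sq => by
  let φ (c : C) (hc : deg c < deg x) (f : c ⟶ x) (t : W.obj c) : L ⟶ X :=
    copowersι L t ≫ relLatchingInl deg (copowersMap W i) x hc f ≫ a
  have hφ := hW x (L ⟶ X) φ (fun c c' hc hc' k f t => by
    simp only [φ, ← reassoc_of% (map_relLatchingInl (copowersMap W i) hc hc'),
      reassoc_of% copowersι_map])
  have wr (c : C) (hc : deg c < deg x) (f : c ⟶ x) (t : W.obj c) :
      φ c hc f t ≫ p = copowersι L (W.map f t) ≫ b := by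
    simp only [φ, Category.assoc, sq.w, reassoc_of% relLatchingInl_relLatchingMap,
      reassoc_of% copowersι_map]
  have wl (c : C) (hc : deg c < deg x) (f : c ⟶ x) (t : W.obj c) :
      i ≫ φ c hc f t =
        copowersι K (W.map f t) ≫ relLatchingInr deg (copowersMap W i) x ≫ a := by
    simp only [φ, ← reassoc_of% copowersι_copowersMap_app, reassoc_of% app_relLatchingInl,
      reassoc_of% copowersι_map]
  have (s : W.obj x) : ∃ l : L ⟶ X,
      i ≫ l = copowersι K s ≫ relLatchingInr deg (copowersMap W i) x ≫ a ∧
      l ≫ p = copowersι L s ≫ b ∧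
      ∀ (c : C) (hc : deg c < deg x) (f : c ⟶ x) (t : W.obj c), W.map f t = s →
        l = φ c hc f t := by
    by_cases hs : ∃ (c : C) (_ : deg c < deg x) (f : c ⟶ x) (t : W.obj c), W.map f t = s
    · obtain ⟨c, hc, f, t, rfl⟩ := hs
      exact ⟨φ c hc f t, wl c hc f t, wr c hc f t, fun c' hc' f' t' e =>
        hφ c c' hc hc' f f' t t' e.symm⟩
    · have sq' : CommSq (copowersι K s ≫ relLatchingInr deg (copowersMap W i) x ≫ a) i p
          (copowersι L s ≫ b) := ⟨by
        simp only [Category.assoc, sq.w, reassoc_of% relLatchingInr_relLatchingMap,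
          reassoc_of% copowersι_copowersMap_app]⟩
      exact ⟨sq'.lift, sq'.fac_left, sq'.fac_right, fun c hc f t e => (hs ⟨c, hc, f, t, e⟩).elim⟩
  choose l hl₁ hl₂ hl₃ using this
  refine ⟨⟨{ l := copowersDesc l, fac_left := ?_, fac_right := ?_ }⟩⟩
  · refine relLatching_hom_ext (fun c hc f => copowers_hom_ext fun s => ?_)
      (copowers_hom_ext fun s => ?_)
    · simp only [reassoc_of% relLatchingInl_relLatchingMap, reassoc_of% copowersι_map,
        copowersι_desc]
      exact hl₃ _ c hc f s rfl
    · simp only [reassoc_of% relLatchingInr_relLatchingMap, reassoc_of% copowersι_copowersMap_app,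
        copowersι_desc, hl₁]
  · exact copowers_hom_ext fun s => by rw [reassoc_of% copowersι_desc, hl₂]⟩

end

end Powers

/-! ## Detecting `L`-objects in the category of sets and its opposite -/

section Detection

variable {C : Type u} [SmallCategory C] {deg : C → Ordinal.{v}}

/-- The transformation `b` is a point of `{W, B}`. Pulling `{W, f}` back along that point gives its
fibre, the set of lifts of `b`, over a one-point set; being a weak equivalence forces the fibre to
be nonempty. -/
lemma exists_lift_of_universally_nonempty {W A B : C ⥤ Type u} (f : A ⟶ B)
    (hf : universally (fun X Y _ => Nonempty Y → Nonempty X) ((weightedLim W).map f))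
    (b : W ⟶ B) : ∃ a : W ⟶ A, a ≫ f = b := by
  let e : PUnit ⟶ (weightedLim W).obj B :=
    weightedLimLift B (fun c t => ↾fun _ => b.app c t)
      (fun k t => by ext; exact (NatTrans.naturality_apply b k t).symm)
  have sq := IsPullback.of_hasPullback ((weightedLim W).map f) e
  obtain ⟨z⟩ := hf _ _ _ sq.flip ⟨PUnit.unit⟩
  refine ⟨{ app := fun c => ↾fun t => weightedLimπ A t (pullback.fst _ e z)
            naturality := fun c c' k => ?_ }, ?_⟩
  · ext t
    exact (ConcreteCategory.congr_hom (weightedLimπ_map A k t) _).symm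
  · ext c t
    have h : pullback.fst _ e ≫ weightedLimπ A t ≫ f.app c =
        pullback.snd ((weightedLim W).map f) e ≫ ↾fun _ => b.app c t := by
      rw [← weightedLim_map_π, pullback.condition_assoc, weightedLimLift_π]
    exact ConcreteCategory.congr_hom h z

/-- The same fibre argument read in the opposite category: there `U ⊗ A` is the set of
transformations `A ⟶ U.rightOp`, a map from it to `op PUnit` is one such transformation, and the
pushout is the set of its extensions along `f`. -/
lemma exists_extension_of_couniversally_nonempty {U : Cᵒᵖ ⥤ Type u} {A B : C ⥤ (Type u)ᵒᵖ}
    (f : A ⟶ B)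
    (hf : couniversally (MorphismProperty.op fun X Y _ => Nonempty Y → Nonempty X)
      ((weightedColim U).map f))
    (a : A ⟶ U.rightOp) : ∃ b : B ⟶ U.rightOp, f ≫ b = a := by
  let e : (weightedColim U).obj A ⟶ op PUnit :=
    weightedColimDesc A (fun c s => Quiver.Hom.op (↾fun _ => (a.app c).unop s))
      (fun k s => Quiver.Hom.unop_inj (by
        ext
        exact ConcreteCategory.congr_hom (congrArg Quiver.Hom.unop (a.naturality k)) s))
  have sq := IsPushout.of_hasPushout ((weightedColim U).map f) e
  obtain ⟨z⟩ := hf _ _ _ sq ⟨PUnit.unit⟩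
  refine ⟨{ app := fun c => Quiver.Hom.op
              (↾fun s => (weightedColimι B s).unop ((pushout.inl _ e).unop z))
            naturality := fun c c' k => Quiver.Hom.unop_inj ?_ }, ?_⟩
  · ext s
    exact ConcreteCategory.congr_hom (congrArg Quiver.Hom.unop (map_weightedColimι B k s)) _
  · ext c
    refine Quiver.Hom.unop_inj ?_
    ext s
    have h : f.app c ≫ weightedColimι B s ≫ pushout.inl _ e =
        Quiver.Hom.op (↾fun _ => (a.app c).unop s) ≫
          pushout.inr ((weightedColim U).map f) e := by
      rw [← reassoc_of% weightedColimι_map, pushout.condition,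
        reassoc_of% (weightedColimι_desc (X := A))]
    exact ConcreteCategory.congr_hom (congrArg Quiver.Hom.unop h) z

/-- In the opposite of the category of sets, injectivity of the relative matching maps of
`U.rightOp ⟶ ⊤_ _` amounts to injectivity of the latching maps of `U`. -/
lemma latchingInjective_of_reedyRight_op {U : Cᵒᵖ ⥤ Type u}
    (h : reedyRight deg injections.{u}.op (terminal.from U.rightOp)) :
    LatchingInjective (fun x : Cᵒᵖ => deg x.unop) U := by
  intro x T φ hφ c c' hc hc' f f' w w' e
  have hterm : IsTerminal ((⊤_ (C ⥤ (Type u)ᵒᵖ)).obj x.unop) :=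
    IsTerminal.isTerminalObj ((evaluation C (Type u)ᵒᵖ).obj x.unop) _ terminalIsTerminal
  -- Reversing arrows, `d` is the map `L_x U ⟶ T` induced by `φ`, and `q` below extends it over the
  -- relative latching object, whose remaining summand is empty.
  let d : op T ⟶ (matching deg x.unop).obj U.rightOp :=
    matchingLift U.rightOp (fun c hc f => Quiver.Hom.op (↾(φ (op c) hc f.op)))
      (fun c c' hc hc' k f => Quiver.Hom.unop_inj (by
        ext w
        exact (hφ (op c') (op c) hc' hc k.op f.op w).symm))
  let q : op T ⟶ relMatching deg (terminal.from U.rightOp) x.unop :=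
    pullback.lift d (hterm.from _) (matching_hom_ext fun c hc f =>
      (IsTerminal.isTerminalObj ((evaluation C (Type u)ᵒᵖ).obj c) _ terminalIsTerminal).hom_ext _ _)
  have hq {c : Cᵒᵖ} (hc : deg c.unop < deg x.unop) (f : c ⟶ x) (w : U.obj c) :
      q.unop ((relMatchingFst deg (terminal.from U.rightOp) x.unop hc f.unop).unop w) =
        φ c hc f w := by
    have : q ≫ relMatchingFst deg (terminal.from U.rightOp) x.unop hc f.unop =
        Quiver.Hom.op (↾(φ c hc f)) := by
      rw [relMatchingFst, pullback.lift_fst_assoc]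
      exact matchingLift_π _ _ _ _
    exact ConcreteCategory.congr_hom (congrArg Quiver.Hom.unop this) w
  have key {c : Cᵒᵖ} (hc : deg c.unop < deg x.unop) (f : c ⟶ x) (w : U.obj c) :
      (relMatchingMap deg (terminal.from U.rightOp) x.unop).unop
        ((relMatchingFst deg (terminal.from U.rightOp) x.unop hc f.unop).unop w) = U.map f w :=
    ConcreteCategory.congr_hom (congrArg Quiver.Hom.unop
      (relMatchingMap_relMatchingFst (terminal.from U.rightOp) hc f.unop)) w
  rw [← hq hc, ← hq hc']
  exact congrArg q.unop (h x.unop (by rw [key, key, e]))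

end Detection

/-! ### The two equivalences -/

theorem mainTheorem3 {C : Type u} [SmallCategory C] (deg : C → Ordinal.{v})
    (hC : IsBistratifiedDiscrete deg)
    (hM : ∀ (M : Type (u + 1)) [Category.{u} M] [HasLimits M] [HasColimits M] [ModelCategory M],
      FormModelStructure
        (reedyLeft deg (trivialCofibrations M)) (reedyRight deg (fibrations M))
        (reedyLeft deg (cofibrations M)) (reedyRight deg (trivialFibrations M))
        ((weakEquivalences M).functorCategory C))
    (U : Cᵒᵖ ⥤ Type u) (W : C ⥤ Type u) :
    ((∀ (M : Type (u + 1)) [Category.{u} M] [HasLimits M] [HasColimits M] [ModelCategory M]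
        ⦃A B : C ⥤ M⦄ (f : A ⟶ B), reedyLeft deg (trivialCofibrations M) f →
          couniversally (weakEquivalences M) ((weightedColim U).map f)) ↔
      IsLeftObject (reedyLeft (fun x : Cᵒᵖ => deg x.unop) injections) U) ∧
    ((∀ (M : Type (u + 1)) [Category.{u} M] [HasLimits M] [HasColimits M] [ModelCategory M]
        ⦃A B : C ⥤ M⦄ (f : A ⟶ B), reedyRight deg (trivialFibrations M) f →
          universally (weakEquivalences M) ((weightedLim W).map f)) ↔
      IsLeftObject (reedyLeft deg injections) W) := by
  refine ⟨⟨fun h => ?_, fun hU M _ _ _ _ A B f hf => ?_⟩,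
    ⟨fun h => ?_, fun hW M _ _ _ _ A B f hf => ?_⟩⟩
  · rw [isLeftObject_iff_latchingInjective]
    let := nonemptinessModelCategory.{u}
    have := (hM (Type u)ᵒᵖ).wfs₁
    apply latchingInjective_of_reedyRight_op
    -- In the opposite model structure the fibrations are, by definition, the opposites of the
    -- cofibrations, that is, of the injections.
    change reedyRight deg (fibrations (Type u)ᵒᵖ) _
    rw [← rlp_eq_of_wfs (reedyLeft deg (trivialCofibrations (Type u)ᵒᵖ))
      (reedyRight deg (fibrations (Type u)ᵒᵖ))]
    -- Lifting against a map to the terminal object is just extension of `a` along `f`.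
    intro A B f hf
    refine ⟨fun {a b} _ => ?_⟩
    obtain ⟨l, hl⟩ := exists_extension_of_couniversally_nonempty f (h (Type u)ᵒᵖ f hf) a
    exact ⟨⟨⟨l, hl, terminalIsTerminal.hom_ext _ _⟩⟩⟩
  · rw [isLeftObject_iff_latchingInjective] at hU
    -- More than a weak equivalence is proved, because acyclic cofibrations are stable under pushout
    -- while weak equivalences in general are not.
    have hf' : trivialCofibrations M ((weightedColim U).map f) := by
      rw [← llp_eq_of_wfs (trivialCofibrations M) (fibrations M)]
      intro X Y p hp
      have hp' : reedyRight deg (fibrations M) (powersMap U p) := by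
        intro x
        rw [← rlp_eq_of_wfs (trivialCofibrations M) (fibrations M)]
        intro K L i hi
        have := hasLiftingProperty_of_wfs i p hi hp
        exact hasLiftingProperty_relMatchingMap_powersMap hU i p x
      have := (hM M).wfs₁
      have := hasLiftingProperty_of_wfs f _ hf hp'
      exact hasLiftingProperty_weightedColim_map f p
    intro X' Y' g g' f' sq
    exact (MorphismProperty.of_isPushout (P := trivialCofibrations M) sq.flip hf').2
  · let := nonemptinessModelCategory.{u}
    have := (hM (Type u)).wfs₂
    change reedyLeft deg (cofibrations (Type u)) (initial.to W)
    rw [← llp_eq_of_wfs (reedyLeft deg (cofibrations (Type u)))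
      (reedyRight deg (trivialFibrations (Type u)))]
    -- Lifting a map from the initial object against `f` only asks for a lift of `b : W ⟶ B`.
    intro A B f hf
    refine ⟨fun {a b} _ => ?_⟩
    obtain ⟨l, hl⟩ := exists_lift_of_universally_nonempty f (h (Type u) f hf) b
    exact ⟨⟨⟨l, initialIsInitial.hom_ext _ _, hl⟩⟩⟩
  · rw [isLeftObject_iff_latchingInjective] at hW
    -- Again the stronger class is the one stable under base change.
    have hf' : trivialFibrations M ((weightedLim W).map f) := by
      rw [← rlp_eq_of_wfs (cofibrations M) (trivialFibrations M)]
      intro K L i hi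
      have hi' : reedyLeft deg (cofibrations M) (copowersMap W i) := by
        intro x
        rw [← llp_eq_of_wfs (cofibrations M) (trivialFibrations M)]
        intro X Y p hp
        have := hasLiftingProperty_of_wfs i p hi hp
        exact hasLiftingProperty_relLatchingMap_copowersMap hW i p x
      have := (hM M).wfs₂
      have := hasLiftingProperty_of_wfs _ f hi' hf
      exact hasLiftingProperty_weightedLim_map f i
    intro X' Y' g g' f' sq
    exact (MorphismProperty.of_isPullback (P := trivialFibrations M) sq.flip hf').2
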